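/- **Theorem 2.** Let $H_1,H_2$ be separable real Hilbert spaces, $\Psi:H_1\to H_2$ a bounded linear operator, and $$Y_k=\Psi(X_k)+\varepsilon_k,\qquad k\ge 1,$$ where all random variables are defined on one probability space. For $x\in H_i$, $y\in H_j$ write $x\otimes y$ for the operator $v\mapsto\langle x,v\rangle y$. Assume the following. (i) There are i.i.d. random elements $(\delta_i)_{i\in\mathbb Z}$ of a measurable space $S$ and measurable $f:S^{\mathbb N}\to H_1$, $g:S^{\mathbb N}\to H_2$ such that, for all $k\ge1$, almost surely $X_k=f(\delta_k,\delta_{k-1},\dots)$ and $\varepsilon_k=g(\delta_k,\delta_{k-1},\dots)$. Moreover $E\|X_k\|^4<\infty$, $E\|\varepsilon_k\|^4<\infty$, and $$\sum_{m\ge1}\big(E\|X_m-X_m^{(m)}\|^4\big)^{1/4}<\infty,\qquad \sum_{m\ge1}\big(E\|\varepsilon_m-\varepsilon_m^{(m)}\|^4\big)^{1/4}<\infty,$$ where $X_m^{(m)}=f(\delta_m,\dots,\delta_1,\delta_0',\delta_{-1}',\dots)$, $\varepsilon_m^{(m)}=g(\delta_m,\dots,\delta_1,\delta_0',\delta_{-1}',\dots)$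 and $(\delta_i')$ is an independent copy of $(\delta_i)$ (on an enlarged probability space if necessary). That is, $(X_k)$ and $(\varepsilon_k)$ are $L^4$-$m$-approximable with common innovations. (ii) $EX_k=0$ and $E\varepsilon_k=0$ for all $k\geq 1$; $(\varepsilon_k)$ is $H_2$-white noise, i.e. $E[\varepsilon_k\otimes\varepsilon_l]=0$ for $k\ne l$ and the covariance operator of $\varepsilon_k$ does not depend on $k$; and $E[X_k\otimes\varepsilon_k]=0$ for all $k\ge1$. Let $\hat C_n=\frac1n\sum_{k=1}^nX_k\otimes X_k$ and $\hat\Delta_n=\frac1n\sum_{k=1}^nX_k\otimes Y_k$. Let $\hat\lambda_1\ge\hat\lambda_2\ge\dots\ge0$ be the eigenvalues of $\hat C_n$, listed with multiplicity and continued by zeros, and let $\hat v_1,\hat v_2,\dots$ be any choice of corresponding eigenvectors such that those belonging to nonzero eigenvalues form an orthonormal basis of the image of $\hat C_n$. Let $(m_n)$ be real numbers with $m_n\to\infty$ and $m_n=o(\sqrt n)$, and put $$K_n=\arg\max\{j\ge1:\hat\lambda_1/\hat\lambda_j\le m_n\},\qquad \hat\Psi_{K_n}(x)=\sum_{j=1}^{K_n}\frac{\hat\Delta_n(\hat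 v_j)}{\hat\lambda_j}\langle\hat v_j,x\rangle ,$$ where only $j$ with $\hat\lambda_j>0$ are admitted, and $K_n=0$, $\hat\Psi_{K_n}=0$ if there is no such $j$. Then $$\|\Psi(X_n)-\hat\Psi_{K_n}(X_n)\|_{H_2}\to0\quad\text{in probability as } n\to\infty .$$ -/

import Mathlib

open MeasureTheory ProbabilityTheory Filter Topology
open scoped ENNReal RealInnerProductSpace

noncomputable section

namespace FunctionalRegression

variable {Ω S H H₁ H₂ : Type*}

section Operators

variable [NormedAddCommGroup H] [InnerProductSpace ℝ H]
  [NormedAddCommGroup H₁] [InnerProductSpace ℝ H₁]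
  [NormedAddCommGroup H₂] [InnerProductSpace ℝ H₂]

/-- The operator `x ⊗ y : H₁ → H₂`, `v ↦ ⟪x, v⟫ y`. -/
def tens (x : H₁) (y : H₂) : H₁ →L[ℝ] H₂ := (innerSL ℝ x).smulRight y

/-- `n⁻¹ ∑_{k=1}^n X_k ⊗ Y_k`. -/
def crossCovHat (X : ℕ → Ω → H₁) (Y : ℕ → Ω → H₂) (n : ℕ) (ω : Ω) : H₁ →L[ℝ] H₂ :=
  (n : ℝ)⁻¹ • ∑ k ∈ Finset.Icc 1 n, tens (X k ω) (Y k ω)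

/-- The empirical covariance operator `n⁻¹ ∑_{k=1}^n X_k ⊗ X_k`. -/
def covHat (X : ℕ → Ω → H) (n : ℕ) (ω : Ω) : H →L[ℝ] H := crossCovHat X X n ω

/-- `(lam j, v j)`, `j ≥ 1`, lists the eigenvalues of the nonnegative compact operator `T` in
decreasing order, with multiplicity, and corresponding eigenvectors: the eigenvectors that belong
to the nonzero eigenvalues form an orthonormal basis of the closure of the image of `T`.
If `T` has finite rank the list of eigenvalues is continued by zeros; nothing but `T (v j) = 0`
is required of the corresponding `v j`. The entry with index `0` plays no role. -/
structure IsEigenSystem (T : H →L[ℝ] H) (lam : ℕ → ℝ) (v : ℕ → H) : Prop where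
  antitone : AntitoneOn lam (Set.Ici 1)
  nonneg : ∀ j, 1 ≤ j → 0 ≤ lam j
  eigen : ∀ j, 1 ≤ j → T (v j) = lam j • v j
  orthonormal : Orthonormal ℝ (fun j : {j : ℕ // 1 ≤ j ∧ lam j ≠ 0} => v j)
  complete : closure (Submodule.span ℝ (v '' {j | 1 ≤ j ∧ lam j ≠ 0}) : Set H)
    = closure (Set.range T)

/-- `K = argmax {j ≥ 1 | lam 1 / lam j ≤ m}`, where the ratio counts as infinite if `lam j = 0`;
`K = 0` if there is no such `j`. -/
def truncLevel (lam : ℕ → ℝ) (m : ℝ) : ℕ :=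
  sSup {j : ℕ | 1 ≤ j ∧ 0 < lam j ∧ lam 1 / lam j ≤ m}

/-- The principal components estimator `x ↦ ∑_{j=1}^K ⟪v j, x⟫ / lam j • D (v j)`. -/
def pcEstimator (D : H₁ →L[ℝ] H₂) (lam : ℕ → ℝ) (v : ℕ → H₁) (K : ℕ) (x : H₁) : H₂ :=
  ∑ j ∈ Finset.Icc 1 K, (⟪v j, x⟫ / lam j) • D (v j)

end Operators

section Processes

variable [MeasurableSpace Ω] [MeasurableSpace S]

/-- `(δ i)`, `i ∈ ℤ`, are i.i.d. random elements of `S`. -/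
structure IsIID (P : Measure Ω) (δ : ℤ → Ω → S) : Prop where
  measurable : ∀ i, Measurable (δ i)
  indep : iIndepFun δ P
  ident : ∀ i, IdentDistrib (δ i) (δ 0) P P

/-- The sequence `(δ_n, δ_{n-1}, δ_{n-2}, …)`. -/
def past (δ : ℤ → Ω → S) (n : ℤ) (ω : Ω) : ℕ → S := fun i => δ (n - i) ω

/-- The sequence `(δ_n, …, δ_{n-m+1}, δ'_{n-m}, δ'_{n-m-1}, …)`, where `δ'` is the independent
copy of `δ` that lives on the second factor of the product space `Ω × Ω`. -/
def coupledPast (δ : ℤ → Ω → S) (n : ℤ) (m : ℕ) (z : Ω × Ω) : ℕ → S :=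
  fun i => if i < m then δ (n - i) z.1 else δ (n - i) z.2

/-- `(X n)`, `n ≥ 1`, is an `L^p`-`m`-approximable sequence driven by the i.i.d. sequence `δ`:
it has `p` moments, `X_n = f (δ_n, δ_{n-1}, …)` with `f` measurable, and
`∑_{m ≥ 1} (E ‖X_m - X_m^{(m)}‖^p)^{1/p} < ∞` for
`X_m^{(m)} = f (δ_m, …, δ_1, δ'_0, δ'_{-1}, …)`. -/
structure IsLpMApproximable [NormedAddCommGroup H] [MeasurableSpace H]
    (p : ℝ≥0∞) (P : Measure Ω) (δ : ℤ → Ω → S) (X : ℕ → Ω → H) : Prop where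
  iid : IsIID P δ
  memLp : ∀ n, 1 ≤ n → MemLp (X n) p P
  approx : ∃ f : (ℕ → S) → H, Measurable f ∧
    (∀ n, 1 ≤ n → X n =ᵐ[P] fun ω => f (past δ n ω)) ∧
    ∑' m : ℕ, eLpNorm (fun z : Ω × Ω => X (m + 1) z.1 - f (coupledPast δ (m + 1 : ℕ) (m + 1) z))
      p (P.prod P) < ∞

/-- `X ⊥ Y`: `E[X ⊗ Y] = 0`. -/
def IsOrthogonal [NormedAddCommGroup H₁] [InnerProductSpace ℝ H₁]
    [NormedAddCommGroup H₂] [InnerProductSpace ℝ H₂]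
    (P : Measure Ω) (X : Ω → H₁) (Y : Ω → H₂) : Prop :=
  ∫ ω, tens (X ω) (Y ω) ∂P = 0

/-- The covariance operator `E[(X - EX) ⊗ (X - EX)]`. -/
def covOp [NormedAddCommGroup H] [InnerProductSpace ℝ H]
    (P : Measure Ω) (X : Ω → H) : H →L[ℝ] H :=
  ∫ ω, tens (X ω - ∫ ω', X ω' ∂P) (X ω - ∫ ω', X ω' ∂P) ∂P

/-- `(ε k)`, `k ≥ 1`, is `H`-white noise: square integrable, pairwise orthogonal, with constant
mean and constant covariance operator. -/
structure IsWhiteNoise [NormedAddCommGroup H] [InnerProductSpace ℝ H]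
    (P : Measure Ω) (ε : ℕ → Ω → H) : Prop where
  memLp : ∀ k, 1 ≤ k → MemLp (ε k) 2 P
  orthogonal : ∀ k l, 1 ≤ k → 1 ≤ l → k ≠ l → IsOrthogonal P (ε k) (ε l)
  mean : ∀ k, 1 ≤ k → ∫ ω, ε k ω ∂P = ∫ ω, ε 1 ω ∂P
  cov : ∀ k, 1 ≤ k → covOp P (ε k) = covOp P (ε 1)

/-- The assumptions on regressors `(X k)` and noise `(ε k)`, `k ≥ 1`: both are centred and
`L⁴`-`m`-approximable, driven by the same i.i.d. sequence `δ`; `(ε k)` is white noise; and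
`X k ⊥ ε k`. -/
structure AssumptionA [NormedAddCommGroup H₁] [InnerProductSpace ℝ H₁] [MeasurableSpace H₁]
    [NormedAddCommGroup H₂] [InnerProductSpace ℝ H₂] [MeasurableSpace H₂]
    (P : Measure Ω) (δ : ℤ → Ω → S) (X : ℕ → Ω → H₁) (ε : ℕ → Ω → H₂) : Prop where
  approx_X : IsLpMApproximable 4 P δ X
  approx_ε : IsLpMApproximable 4 P δ ε
  mean_X : ∀ k, 1 ≤ k → ∫ ω, X k ω ∂P = 0
  mean_ε : ∀ k, 1 ≤ k → ∫ ω, ε k ω ∂P = 0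
  whiteNoise : IsWhiteNoise P ε
  orthogonal : ∀ k, 1 ≤ k → IsOrthogonal P (X k) (ε k)

end Processes

end FunctionalRegression

end

/-! Let Ĉ be the sample covariance, L the sample cross covariance of X and ε, and Π the projection
on the first K eigenvectors. The model gives Δ̂ = ΨĈ + L, and Ĉ v_j = λ_j v_j cancels the
denominators, so the estimator at x equals Ψ(Πx) + L(∑_{j ≤ K} (⟪v_j, x⟫/λ_j) v_j). Retained
eigenvalues are at least λ_1/m_n, so the noise term is at most ‖L‖ (m_n/λ_1) ‖x‖. Discarded ones are
below λ_1/m_n, so ‖(I − Π)Ĉ‖ ≤ λ_1/m_n.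

For the bias, X_n lies almost surely in the closure of the range of C = E[X_1 ⊗ X_1], hence with
high probability near C u for one of finitely many u (`exists_measure_preimage_compl_lt`). On x = (x
− C u) + (C − Ĉ)u + Ĉu each piece of (I − Π)x is small (`IsEigenSystem.norm_sub_pcEstimator_le`).
Neither a spectral gap nor convergence of eigenvectors enters.

The probabilistic input is `exists_measure_crossCovHat_sub_le`: Ĉ − C and L are of order n^(-1/2) in
probability. Then λ_1 = ‖Ĉ‖ stays near ‖C‖, m_n = o(√n) removes the noise, and m_n → ∞ removes the
bias. The rate comes from a variance computation in Hilbert–Schmidt norm: coupling bounds the lag-d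
covariance of the centred tensors by a summable sequence. -/

noncomputable section

namespace FunctionalRegression

/-! ### Re-indexing and splicing of i.i.d. sequences -/

section ProductMeasure

variable {S : Type*} [MeasurableSpace S] (μ : Measure S) [IsProbabilityMeasure μ]

/-- The law of an i.i.d. sequence with marginal `μ`. -/
abbrev iidLaw : Measure (ℕ → S) := Measure.infinitePi fun _ : ℕ => μ

/-- The sequence that follows `z.1` at the indices `i < m` and `z.2` from there on. -/
def splice (m : ℕ) (z : (ℕ → S) × (ℕ → S)) : ℕ → S := fun i => if i < m then z.1 i else z.2 i

lemma measurable_splice (m : ℕ) : Measurable (splice (S := S) m) := by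
  refine measurable_pi_iff.2 fun i => ?_
  unfold splice
  split_ifs <;> fun_prop

lemma measurePreserving_infinitePi_comp {ι κ : Type*} {σ : κ → ι} (hσ : Function.Injective σ) :
    MeasurePreserving (fun (p : ι → S) k => p (σ k)) (Measure.infinitePi fun _ : ι => μ)
      (Measure.infinitePi fun _ : κ => μ) :=
  ⟨by fun_prop, Measure.map_infinitePi_infinitePi_of_inj hσ⟩

/-- Turns a pair of independent sequences into one i.i.d. family, so that independence claims become
injectivity of an index map. -/
lemma measurePreserving_sumPiEquivProdPi_symm (ι κ : Type*) :
    MeasurePreserving (MeasurableEquiv.sumPiEquivProdPi fun _ : ι ⊕ κ => S).symm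
      ((Measure.infinitePi fun _ : ι => μ).prod (Measure.infinitePi fun _ : κ => μ))
      (Measure.infinitePi fun _ : ι ⊕ κ => μ) := by
  refine ⟨MeasurableEquiv.measurable _, Measure.eq_infinitePi _ fun s t ht => ?_⟩
  have hpre : (MeasurableEquiv.sumPiEquivProdPi fun _ : ι ⊕ κ => S).symm ⁻¹' Set.pi s t
      = (Set.pi s.toLeft fun i => t (.inl i)) ×ˢ (Set.pi s.toRight fun i => t (.inr i)) := by
    ext z
    simp [Set.mem_pi, Sum.forall, MeasurableEquiv.sumPiEquivProdPi, Equiv.sumPiEquivProdPi]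
  rw [MeasurableEquiv.map_apply, hpre, Measure.prod_prod,
    Measure.infinitePi_pi _ (fun i _ => ht _), Measure.infinitePi_pi _ (fun i _ => ht _)]
  conv_rhs => rw [← Finset.toLeft_disjSum_toRight (u := s), Finset.prod_disjSum]

/-- If `p` and `q` are independent i.i.d. sequences, then so are the tail `(p m, p (m + 1), …)`
and `(p 0, …, p (m - 1), q m, q (m + 1), …)`. -/
lemma measurePreserving_tail_splice (m : ℕ) :
    MeasurePreserving (fun z : (ℕ → S) × (ℕ → S) => ((fun i => z.1 (i + m)), splice m z))
      ((iidLaw μ).prod (iidLaw μ)) ((iidLaw μ).prod (iidLaw μ)) := by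
  -- The tail reads the left coordinates from `m` on; the splice reads the left ones below `m` and
  -- the right ones from `m` on. These are disjoint.
  let σ : ℕ ⊕ ℕ → ℕ ⊕ ℕ :=
    Sum.elim (fun i => .inl (i + m)) (fun i => if i < m then .inl i else .inr i)
  have hσ : Function.Injective σ := by
    rintro (i | i) (j | j) h <;> simp only [σ, Sum.elim_inl, Sum.elim_inr] at h
    · simpa using h
    · split_ifs at h
      simp at h; omega
    · split_ifs at h
      simp at h; omega
    · split_ifs at h <;> simp at h <;> simp [h]
  have he := measurePreserving_sumPiEquivProdPi_symm μ ℕ ℕ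
  have h := (he.symm _).comp ((measurePreserving_infinitePi_comp μ hσ).comp he)
  convert h using 1
  ext z i
  · rfl
  · by_cases hi : i < m <;>
      simp [splice, hi, σ, MeasurableEquiv.sumPiEquivProdPi, Equiv.sumPiEquivProdPi]

lemma measurePreserving_splice (m : ℕ) :
    MeasurePreserving (splice m) ((iidLaw μ).prod (iidLaw μ)) (iidLaw μ) :=
  measurePreserving_snd.comp (measurePreserving_tail_splice μ m)

lemma measurePreserving_tail (m : ℕ) :
    MeasurePreserving (fun (p : ℕ → S) i => p (i + m)) (iidLaw μ) (iidLaw μ) :=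
  measurePreserving_infinitePi_comp μ (add_left_injective m)

end ProductMeasure

/-! ### Transfer of the innovations to sequence space -/

section Past

lemma coupledPast_eq_splice {Ω S : Type*} {δ : ℤ → Ω → S} (n : ℤ) (m : ℕ) (z : Ω × Ω) :
    coupledPast δ n m z = splice m (past δ n z.1, past δ n z.2) := rfl

lemma past_eq_tail_past {Ω S : Type*} {δ : ℤ → Ω → S} (n : ℤ) (m : ℕ) (ω : Ω) :
    past δ n ω = fun i => past δ (n + m) ω (i + m) := by
  ext i
  simp only [past]
  congr 1
  push_cast
  ring

variable {Ω S : Type*} [MeasurableSpace Ω] [MeasurableSpace S] {P : Measure Ω}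
  {δ : ℤ → Ω → S}

/-- The law is the same for every `n`: this is the stationarity used throughout. -/
lemma IsIID.measurePreserving_past (hδ : IsIID P δ) (n : ℤ) :
    MeasurePreserving (past δ n) P (iidLaw (P.map (δ 0))) := by
  refine ⟨measurable_pi_iff.2 fun i => hδ.measurable _, ?_⟩
  have hinj : Function.Injective fun i : ℕ => n - (i : ℤ) := fun i j h => by simpa using h
  have h := (hδ.indep.precomp hinj).map_fun_eq_infinitePi_map fun i => hδ.measurable _
  have h' : (fun i : ℕ => P.map (δ (n - i))) = fun _ => P.map (δ 0) :=
    funext fun i => (hδ.ident _).map_eq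
  change P.map (fun ω i => δ (n - (i : ℕ)) ω) = _
  rw [h]
  congr 1

variable [IsProbabilityMeasure P]

lemma IsIID.isProbabilityMeasure_map (hδ : IsIID P δ) : IsProbabilityMeasure (P.map (δ 0)) :=
  Measure.isProbabilityMeasure_map (hδ.measurable 0).aemeasurable

lemma IsIID.measurePreserving_past_prod (hδ : IsIID P δ) (n : ℤ) :
    MeasurePreserving (fun z : Ω × Ω => (past δ n z.1, past δ n z.2)) (P.prod P)
      ((iidLaw (P.map (δ 0))).prod (iidLaw (P.map (δ 0)))) := by
  have := hδ.isProbabilityMeasure_map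
  exact (hδ.measurePreserving_past n).prod (hδ.measurePreserving_past n)

end Past

/-! ### Covariance decay by coupling -/

section Covariance

lemma integral_comp_of_measurePreserving {α β G : Type*} [MeasurableSpace α] [MeasurableSpace β]
    [NormedAddCommGroup G] [NormedSpace ℝ G] {μ : Measure α} {ν : Measure β} {T : α → β}
    (hT : MeasurePreserving T μ ν) {h : β → G} (hh : AEStronglyMeasurable h ν) :
    ∫ x, h (T x) ∂μ = ∫ y, h y ∂ν := by
  rw [← hT.map_eq] at hh ⊢
  rw [integral_map hT.aemeasurable hh]

lemma integrable_inner {α G : Type*} [MeasurableSpace α] [NormedAddCommGroup G]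
    [InnerProductSpace ℝ G] {μ : Measure α} {a b : α → G} (ha : MemLp a 2 μ) (hb : MemLp b 2 μ) :
    Integrable (fun x => ⟪a x, b x⟫) μ :=
  memLp_one_iff_integrable.1 <| MemLp.of_bilin (fun x y : G => ⟪x, y⟫) 1 ha hb
    (ha.1.inner hb.1) (.of_forall fun x => by simpa using nnnorm_inner_le_nnnorm (𝕜 := ℝ) _ _)

lemma abs_integral_inner_le {α G : Type*} [MeasurableSpace α] [NormedAddCommGroup G]
    [InnerProductSpace ℝ G] {μ : Measure α} {a b : α → G} (ha : MemLp a 2 μ) (hb : MemLp b 2 μ) :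
    |∫ x, ⟪a x, b x⟫ ∂μ| ≤ (eLpNorm a 2 μ).toReal * (eLpNorm b 2 μ).toReal := by
  have h : ⟪ha.toLp a, hb.toLp b⟫ = ∫ x, ⟪a x, b x⟫ ∂μ := by
    rw [L2.inner_def]
    refine integral_congr_ae ?_
    filter_upwards [ha.coeFn_toLp, hb.coeFn_toLp] with x h1 h2
    rw [h1, h2]
  rw [← h, ← Lp.norm_toLp a ha, ← Lp.norm_toLp b hb]
  exact abs_real_inner_le_norm _ _

variable {S G : Type*} [MeasurableSpace S] {μ : Measure S} [IsProbabilityMeasure μ]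
  [NormedAddCommGroup G]

/-- The `L^p` distance of `F (p 0, p 1, …)` and `F (p 0, …, p (m - 1), q m, q (m + 1), …)`
for independent i.i.d. sequences `p` and `q`. -/
def couplingDist (μ : Measure S) (p : ℝ≥0∞) (F : (ℕ → S) → G) (m : ℕ) : ℝ≥0∞ :=
  eLpNorm (fun z => F z.1 - F (splice m z)) p
    ((Measure.infinitePi fun _ : ℕ => μ).prod (Measure.infinitePi fun _ : ℕ => μ))

lemma memLp_sub_splice {p : ℝ≥0∞} {F : (ℕ → S) → G} (hF : MemLp F p (iidLaw μ)) (m : ℕ) :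
    MemLp (fun z => F z.1 - F (splice m z)) p ((iidLaw μ).prod (iidLaw μ)) :=
  (hF.comp_measurePreserving measurePreserving_fst).sub
    (hF.comp_measurePreserving (measurePreserving_splice μ m))

variable [InnerProductSpace ℝ G]

/-- The tail is independent of the splice and `F` is centred, so subtracting `F (splice m z)` from
the second factor does not change the integral. Cauchy–Schwarz does the rest. -/
lemma abs_integral_inner_tail_le [CompleteSpace G] {F : (ℕ → S) → G}
    (hF : MemLp F 2 (iidLaw μ)) (hF0 : ∫ p, F p ∂(iidLaw μ) = 0) (m : ℕ) :
    |∫ p, ⟪F fun i => p (i + m), F p⟫ ∂(iidLaw μ)|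
      ≤ (eLpNorm F 2 (iidLaw μ)).toReal * (couplingDist μ 2 F m).toReal := by
  set ν := iidLaw μ
  have htail : MemLp (fun p : ℕ → S => F fun i => p (i + m)) 2 ν :=
    hF.comp_measurePreserving (measurePreserving_tail μ m)
  have hfst : MemLp (fun z : (ℕ → S) × (ℕ → S) => F z.1) 2 (ν.prod ν) :=
    hF.comp_measurePreserving measurePreserving_fst
  have hsnd : MemLp (fun z : (ℕ → S) × (ℕ → S) => F z.2) 2 (ν.prod ν) :=
    hF.comp_measurePreserving measurePreserving_snd
  have htail1 : MemLp (fun z : (ℕ → S) × (ℕ → S) => F fun i => z.1 (i + m)) 2 (ν.prod ν) :=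
    htail.comp_measurePreserving measurePreserving_fst
  have hspl : MemLp (fun z => F (splice m z)) 2 (ν.prod ν) :=
    hF.comp_measurePreserving (measurePreserving_splice μ m)
  have h1 : ∫ z, ⟪F fun i => z.1 (i + m), F z.1⟫ ∂(ν.prod ν)
      = ∫ p, ⟪F fun i => p (i + m), F p⟫ ∂ν :=
    integral_comp_of_measurePreserving (measurePreserving_fst (μ := ν) (ν := ν))
      (h := fun p : ℕ → S => ⟪F fun i => p (i + m), F p⟫) (htail.1.inner hF.1)
  have h2 : ∫ z, ⟪F fun i => z.1 (i + m), F (splice m z)⟫ ∂(ν.prod ν) = 0 := by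
    rw [integral_comp_of_measurePreserving (measurePreserving_tail_splice μ m)
      (h := fun w => ⟪F w.1, F w.2⟫) (hfst.1.inner hsnd.1),
      integral_prod _ (integrable_inner hfst hsnd)]
    simp [integral_inner (hF.integrable one_le_two), hF0, ν]
  have h3 : ∫ p, ⟪F fun i => p (i + m), F p⟫ ∂ν
      = ∫ z, ⟪F fun i => z.1 (i + m), F z.1 - F (splice m z)⟫ ∂(ν.prod ν) := by
    simp_rw [inner_sub_right]
    rw [integral_sub (integrable_inner htail1 hfst) (integrable_inner htail1 hspl), h1, h2,
      sub_zero]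
  rw [h3]
  refine (abs_integral_inner_le htail1 (memLp_sub_splice hF m)).trans_eq ?_
  rw [← eLpNorm_comp_measurePreserving hF.1 ((measurePreserving_tail μ m).comp
    (measurePreserving_fst (μ := ν) (ν := ν)))]
  rfl

/-- Each distance occurs at most once on either side of `k`. This bounds a row of the covariance
matrix uniformly. -/
lemma sum_natDist_le {r : ℕ → ℝ} (hr : ∀ m, 0 ≤ r m) (hs : Summable r) (k : ℕ) (s : Finset ℕ) :
    ∑ l ∈ s, r (Nat.dist k l) ≤ 2 * ∑' m, r m := by
  rw [← Finset.sum_filter_add_sum_filter_not s (fun l => k ≤ l), two_mul]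
  have key : ∀ (t : Finset ℕ) (φ : ℕ → ℕ), Set.InjOn φ t → (∀ l ∈ t, Nat.dist k l = φ l) →
      ∑ l ∈ t, r (Nat.dist k l) ≤ ∑' m, r m := by
    intro t φ hφ he
    rw [Finset.sum_congr rfl fun l hl => by rw [he l hl], ← Finset.sum_image (f := r) hφ]
    exact hs.sum_le_tsum _ fun m _ => hr m
  refine add_le_add (key _ (fun l => l - k) ?_ ?_) (key _ (fun l => k - l) ?_ ?_)
  · intro a ha b hb h
    simp at ha hb h
    omega
  · intro l hl
    simp at hl
    exact Nat.dist_eq_sub_of_le hl.2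
  · intro a ha b hb h
    simp at ha hb h
    omega
  · intro l hl
    simp at hl
    exact Nat.dist_eq_sub_of_le_right hl.2.le

variable {Ω : Type*} [MeasurableSpace Ω] {P : Measure Ω} [IsProbabilityMeasure P] {δ : ℤ → Ω → S}

lemma IsIID.abs_integral_inner_past_le [CompleteSpace G] (hδ : IsIID P δ) {F : (ℕ → S) → G}
    (hF : MemLp F 2 (iidLaw (P.map (δ 0)))) (hF0 : ∫ p, F p ∂(iidLaw (P.map (δ 0))) = 0)
    (k l : ℕ) :
    |∫ ω, ⟪F (past δ k ω), F (past δ l ω)⟫ ∂P| ≤ (eLpNorm F 2 (iidLaw (P.map (δ 0)))).toReal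
      * (couplingDist (P.map (δ 0)) 2 F (Nat.dist k l)).toReal := by
  have := hδ.isProbabilityMeasure_map
  wlog hkl : k ≤ l generalizing k l
  · rw [Nat.dist_comm]
    simp_rw [real_inner_comm (F (past δ l _))]
    exact this l k (by omega)
  obtain ⟨m, rfl⟩ := Nat.exists_eq_add_of_le hkl
  have hd : Nat.dist k (k + m) = m := by rw [Nat.dist_eq_sub_of_le hkl]; omega
  rw [hd]
  refine le_of_eq_of_le ?_ (abs_integral_inner_tail_le hF hF0 m)
  congr 1
  simp_rw [past_eq_tail_past (δ := δ) k m]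
  push_cast
  exact integral_comp_of_measurePreserving (hδ.measurePreserving_past (k + m))
    (h := fun p => ⟪F fun i => p (i + m), F p⟫)
    ((hF.comp_measurePreserving (measurePreserving_tail _ m)).1.inner hF.1)

/-- A centred stationary sequence whose coupling distances are summable has partial sums with
second moments of linear growth. -/
lemma IsIID.exists_integral_norm_sum_past_sq_le [CompleteSpace G] (hδ : IsIID P δ)
    {F : (ℕ → S) → G} (hF : MemLp F 2 (iidLaw (P.map (δ 0))))
    (hF0 : ∫ p, F p ∂(iidLaw (P.map (δ 0))) = 0)
    (hsum : ∑' m, couplingDist (P.map (δ 0)) 2 F (m + 1) < ∞) :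
    ∃ c : ℝ, ∀ n : ℕ, ∫ ω, ‖∑ k ∈ Finset.Icc 1 n, F (past δ k ω)‖ ^ 2 ∂P ≤ c * n := by
  have := hδ.isProbabilityMeasure_map
  set A := (eLpNorm F 2 (iidLaw (P.map (δ 0)))).toReal
  set r : ℕ → ℝ := fun m => A * (couplingDist (P.map (δ 0)) 2 F m).toReal
  have hr : ∀ m, 0 ≤ r m := fun m => by positivity
  have hrs : Summable r := by
    refine Summable.mul_left _ ?_
    -- The hypothesis starts at lag 1; the lag 0 term does not affect summability.
    rw [← summable_nat_add_iff 1]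
    exact ENNReal.summable_toReal hsum.ne
  have hmem : ∀ k : ℕ, MemLp (fun ω => F (past δ k ω)) 2 P := fun k =>
    hF.comp_measurePreserving (hδ.measurePreserving_past k)
  refine ⟨2 * ∑' m, r m, fun n => ?_⟩
  simp_rw [← real_inner_self_eq_norm_sq, sum_inner, inner_sum]
  rw [integral_finsetSum _ fun k _ => integrable_finsetSum _ fun l _ =>
    integrable_inner (hmem k) (hmem l)]
  simp_rw [fun k : ℕ => integral_finsetSum (μ := P) (Finset.Icc 1 n) fun l _ =>
    integrable_inner (hmem k) (hmem l)]
  calc _ ≤ ∑ k ∈ Finset.Icc 1 n, ∑ l ∈ Finset.Icc 1 n, r (Nat.dist k l) :=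
        Finset.sum_le_sum fun k _ => Finset.sum_le_sum fun l _ =>
          (le_abs_self _).trans (hδ.abs_integral_inner_past_le hF hF0 k l)
    _ ≤ ∑ k ∈ Finset.Icc 1 n, 2 * ∑' m, r m :=
        Finset.sum_le_sum fun k _ => sum_natDist_le hr hrs k _
    _ = _ := by simp [mul_comm]

end Covariance

/-! ### Hilbert–Schmidt norm as a Hilbert space majorant of the operator norm -/

section HilbertTensor

open scoped TensorProduct

variable {H₁ H₂ : Type*} [NormedAddCommGroup H₁] [InnerProductSpace ℝ H₁]
  [NormedAddCommGroup H₂] [InnerProductSpace ℝ H₂]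

/-- The Hilbert space tensor product, a model of the Hilbert-Schmidt operators `H₁ → H₂`. -/
def HilbertTensor (H₁ H₂ : Type*) [NormedAddCommGroup H₁] [InnerProductSpace ℝ H₁]
    [NormedAddCommGroup H₂] [InnerProductSpace ℝ H₂] : Type _ :=
  UniformSpace.Completion (H₁ ⊗[ℝ] H₂)

instance : NormedAddCommGroup (HilbertTensor H₁ H₂) :=
  inferInstanceAs (NormedAddCommGroup (UniformSpace.Completion (H₁ ⊗[ℝ] H₂)))

instance : InnerProductSpace ℝ (HilbertTensor H₁ H₂) :=
  inferInstanceAs (InnerProductSpace ℝ (UniformSpace.Completion (H₁ ⊗[ℝ] H₂)))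

instance : CompleteSpace (HilbertTensor H₁ H₂) :=
  inferInstanceAs (CompleteSpace (UniformSpace.Completion (H₁ ⊗[ℝ] H₂)))

/-- The canonical isometric embedding of the algebraic tensor product. -/
def toHilbertTensor : H₁ ⊗[ℝ] H₂ →ₗᵢ[ℝ] HilbertTensor H₁ H₂ :=
  UniformSpace.Completion.toComplₗᵢ

/-- The elementary tensor `x ⊗ y` in the Hilbert space tensor product. -/
def elemTensor (x : H₁) (y : H₂) : HilbertTensor H₁ H₂ := toHilbertTensor (x ⊗ₜ[ℝ] y)

lemma inner_elemTensor (x x' : H₁) (y y' : H₂) :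
    ⟪elemTensor x y, elemTensor x' y'⟫ = ⟪x, x'⟫ * ⟪y, y'⟫ := by
  simp [elemTensor]

lemma norm_elemTensor (x : H₁) (y : H₂) : ‖elemTensor x y‖ = ‖x‖ * ‖y‖ := by
  simp [elemTensor]

lemma continuous_elemTensor : Continuous fun z : H₁ × H₂ => elemTensor z.1 z.2 :=
  toHilbertTensor.continuous.comp TensorProduct.continuous_tmul

lemma elemTensor_sub_elemTensor (x x' : H₁) (y y' : H₂) :
    elemTensor x y - elemTensor x' y' = elemTensor (x - x') y + elemTensor x' (y - y') := by
  simp only [elemTensor, TensorProduct.sub_tmul, TensorProduct.tmul_sub, map_sub]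
  abel

/-- Test with `y = T u`. Second moments are computed in the tensor product, where an inner product
is available, and come back to operators through this bound. -/
lemma opNorm_le_of_inner_eq_inner_elemTensor {T : H₁ →L[ℝ] H₂} {g : HilbertTensor H₁ H₂}
    (h : ∀ u y, ⟪T u, y⟫ = ⟪g, elemTensor u y⟫) : ‖T‖ ≤ ‖g‖ := by
  refine T.opNorm_le_bound (norm_nonneg _) fun u => ?_
  by_cases h0 : ‖T u‖ = 0
  · rw [h0]; positivity
  have h1 : ‖T u‖ * ‖T u‖ ≤ ‖g‖ * ‖u‖ * ‖T u‖ := by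
    rw [← real_inner_self_eq_norm_mul_norm, h, mul_assoc, ← norm_elemTensor]
    exact real_inner_le_norm _ _
  exact le_of_mul_le_mul_right h1 (lt_of_le_of_ne (norm_nonneg _) (Ne.symm h0))

lemma tens_apply (x : H₁) (y : H₂) (u : H₁) : tens x y u = ⟪x, u⟫ • y := rfl

lemma inner_tens_apply (x u : H₁) (y w : H₂) :
    ⟪tens x y u, w⟫ = ⟪elemTensor x y, elemTensor u w⟫ := by
  rw [tens_apply, inner_elemTensor, real_inner_smul_left]

lemma continuous_tens : Continuous fun z : H₁ × H₂ => tens z.1 z.2 := by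
  have h : (fun z : H₁ × H₂ => tens z.1 z.2)
      = fun z => ContinuousLinearMap.smulRightL ℝ H₁ H₂ (innerSL ℝ z.1) z.2 := rfl
  rw [h]
  fun_prop

lemma norm_tens (x : H₁) (y : H₂) : ‖tens x y‖ = ‖x‖ * ‖y‖ := by
  rw [tens, ContinuousLinearMap.norm_smulRight_apply, innerSL_apply_norm]

variable {α : Type*} [MeasurableSpace α] {μ : Measure α} {X : α → H₁} {W : α → H₂}

lemma eLpNorm_elemTensor_le {p q r : ℝ≥0∞} [ENNReal.HolderTriple p q r]
    (hX : AEStronglyMeasurable X μ) (hW : AEStronglyMeasurable W μ) :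
    eLpNorm (fun x => elemTensor (X x) (W x)) r μ ≤ eLpNorm X p μ * eLpNorm W q μ := by
  simpa using eLpNorm_le_eLpNorm_mul_eLpNorm_of_nnnorm (p := p) (q := q) (r := r) hX hW
    elemTensor 1 (.of_forall fun x => by rw [← NNReal.coe_le_coe]; simp [norm_elemTensor])

lemma aestronglyMeasurable_elemTensor (hX : AEStronglyMeasurable X μ)
    (hW : AEStronglyMeasurable W μ) :
    AEStronglyMeasurable (fun x => elemTensor (X x) (W x)) μ := by
  have h : AEStronglyMeasurable (fun x => (X x, W x)) μ := hX.prodMk hW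
  have h' := Continuous.comp_aestronglyMeasurable (g := fun z : H₁ × H₂ => elemTensor z.1 z.2)
    continuous_elemTensor h
  exact h'

lemma memLp_elemTensor {p q r : ℝ≥0∞} [ENNReal.HolderTriple p q r] (hX : MemLp X p μ)
    (hW : MemLp W q μ) : MemLp (fun x => elemTensor (X x) (W x)) r μ :=
  ⟨aestronglyMeasurable_elemTensor hX.1 hW.1,
    (eLpNorm_elemTensor_le (p := p) (q := q) hX.1 hW.1).trans_lt (ENNReal.mul_lt_top hX.2 hW.2)⟩

lemma integrable_tens (hX : MemLp X 2 μ) (hW : MemLp W 2 μ) :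
    Integrable (fun x => tens (X x) (W x)) μ :=
  memLp_one_iff_integrable.1 <| MemLp.of_bilin (tens : H₁ → H₂ → (H₁ →L[ℝ] H₂)) 1 hX hW
    (continuous_tens.comp_aestronglyMeasurable (hX.1.prodMk hW.1))
    (.of_forall fun x => by rw [← NNReal.coe_le_coe]; simp [norm_tens])

lemma inner_integral_tens_apply [CompleteSpace H₂] (hX : MemLp X 2 μ) (hW : MemLp W 2 μ)
    (u : H₁) (y : H₂) :
    ⟪(∫ x, tens (X x) (W x) ∂μ) u, y⟫ = ∫ x, ⟪X x, u⟫ * ⟪W x, y⟫ ∂μ := by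
  have hT := integrable_tens hX hW
  rw [ContinuousLinearMap.integral_apply hT, real_inner_comm,
    ← integral_inner (hT.apply_continuousLinearMap u)]
  refine integral_congr_ae (.of_forall fun x => ?_)
  simp only [tens_apply, real_inner_smul_right, real_inner_comm y]

/-- Same right-hand side as in `inner_integral_tens_apply`: the mean tensor represents the mean
operator. -/
lemma inner_integral_elemTensor (hX : MemLp X 2 μ) (hW : MemLp W 2 μ) (u : H₁) (y : H₂) :
    ⟪∫ x, elemTensor (X x) (W x) ∂μ, elemTensor u y⟫ = ∫ x, ⟪X x, u⟫ * ⟪W x, y⟫ ∂μ := by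
  rw [real_inner_comm, ← integral_inner (memLp_one_iff_integrable.1 (memLp_elemTensor hX hW))]
  refine integral_congr_ae (.of_forall fun x => ?_)
  simp only [inner_elemTensor, real_inner_comm u, real_inner_comm y]

end HilbertTensor

/-! ### Root-n rate for sample covariance operators -/

section SampleCovariance

variable {Ω S H H₁ H₂ : Type*} [MeasurableSpace Ω] [MeasurableSpace S]
  {P : Measure Ω} [IsProbabilityMeasure P] {δ : ℤ → Ω → S}

/-- Moments and coupling distances depend only on the law of the past, so they can be read on
sequence space, free of the time index. -/
lemma IsLpMApproximable.exists_representation [NormedAddCommGroup H]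
    [TopologicalSpace.SeparableSpace H] [MeasurableSpace H] [BorelSpace H] {p : ℝ≥0∞}
    {X : ℕ → Ω → H} (hX : IsLpMApproximable p P δ X) :
    ∃ f : (ℕ → S) → H, StronglyMeasurable f ∧ MemLp f p (iidLaw (P.map (δ 0))) ∧
      (∀ n : ℕ, 1 ≤ n → X n =ᵐ[P] fun ω => f (past δ n ω)) ∧
      ∑' m, couplingDist (P.map (δ 0)) p f (m + 1) < ∞ := by
  have := hX.iid.isProbabilityMeasure_map
  have : SecondCountableTopology H := UniformSpace.secondCountable_of_separable H
  obtain ⟨f, hf, hXf, hsum⟩ := hX.approx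
  have hfm := hf.stronglyMeasurable
  refine ⟨f, hfm, ?_, fun n hn => hXf n hn, ?_⟩
  · have h := (memLp_congr_ae (hXf 1 le_rfl)).1 (hX.memLp 1 le_rfl)
    have hp := hX.iid.measurePreserving_past (1 : ℕ)
    rw [← hp.map_eq]
    exact (memLp_map_measure_iff hfm.aestronglyMeasurable hp.aemeasurable).2 h
  · refine lt_of_eq_of_lt (tsum_congr fun m => ?_) hsum
    have hp := hX.iid.measurePreserving_past_prod (m + 1 : ℕ)
    rw [couplingDist, ← eLpNorm_comp_measurePreserving _ hp]
    · refine eLpNorm_congr_ae ?_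
      have := (Measure.quasiMeasurePreserving_fst (μ := P) (ν := P)).ae_eq_comp
        (hXf (m + 1) (by omega))
      filter_upwards [this] with z hz
      simp only [Function.comp_apply] at hz ⊢
      rw [hz, coupledPast_eq_splice]
    · exact ((hfm.comp_measurable measurable_fst).sub
        (hfm.comp_measurable (measurable_splice _))).aestronglyMeasurable

/-- The random variables of an approximable sequence are identically distributed. -/
lemma IsLpMApproximable.identDistrib [NormedAddCommGroup H]
    [TopologicalSpace.SeparableSpace H] [MeasurableSpace H] [BorelSpace H] {p : ℝ≥0∞}
    {X : ℕ → Ω → H} (hX : IsLpMApproximable p P δ X) {n : ℕ} (hn : 1 ≤ n) :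
    IdentDistrib (X n) (X 1) P P := by
  obtain ⟨f, hf, -, hXf, -⟩ := hX.exists_representation
  have h : ∀ n : ℕ, 1 ≤ n → P.map (X n) = (iidLaw (P.map (δ 0))).map f := fun n hn => by
    have hp := hX.iid.measurePreserving_past n
    rw [Measure.map_congr (hXf n hn), ← hp.map_eq, Measure.map_map hf.measurable hp.measurable]
    rfl
  exact ⟨(hX.memLp n hn).1.aemeasurable, (hX.memLp 1 le_rfl).1.aemeasurable,
    (h n hn).trans (h 1 le_rfl).symm⟩

variable [NormedAddCommGroup H₁] [InnerProductSpace ℝ H₁]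
  [NormedAddCommGroup H₂] [InnerProductSpace ℝ H₂]

instance holderTriple_four_four_two : ENNReal.HolderTriple 4 4 2 where
  inv_add_inv_eq_inv := by
    rw [← two_mul, show (4 : ℝ≥0∞) = 2 * 2 by norm_num,
      ENNReal.mul_inv (by simp) (by simp), ← mul_assoc, ENNReal.mul_inv_cancel (by simp) (by simp),
      one_mul]

/-- Product rule for the difference of two tensors, then Hölder with 1/4 + 1/4 = 1/2; this is where
fourth moments are needed. The constant `M` cancels. -/
lemma couplingDist_elemTensor_sub_le {μ : Measure S} [IsProbabilityMeasure μ]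
    {f : (ℕ → S) → H₁} {g : (ℕ → S) → H₂} (hf : MemLp f 4 (iidLaw μ)) (hg : MemLp g 4 (iidLaw μ))
    (M : HilbertTensor H₁ H₂) (m : ℕ) :
    couplingDist μ 2 (fun p => elemTensor (f p) (g p) - M) m
      ≤ couplingDist μ 4 f m * eLpNorm g 4 (iidLaw μ)
        + eLpNorm f 4 (iidLaw μ) * couplingDist μ 4 g m := by
  have hfs := hf.comp_measurePreserving (measurePreserving_splice μ m)
  have hg1 := hg.comp_measurePreserving
    (measurePreserving_fst (μ := iidLaw μ) (ν := iidLaw μ))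
  have hdf := memLp_sub_splice hf m
  have hdg := memLp_sub_splice hg m
  simp only [couplingDist, sub_sub_sub_cancel_right, elemTensor_sub_elemTensor]
  refine (eLpNorm_add_le (memLp_elemTensor (p := 4) (q := 4) (r := 2) hdf hg1).1
    (memLp_elemTensor (p := 4) (q := 4) (r := 2) hfs hdg).1 one_le_two).trans ?_
  refine add_le_add ((eLpNorm_elemTensor_le (p := 4) (q := 4) hdf.1 hg1.1).trans_eq ?_)
    ((eLpNorm_elemTensor_le (p := 4) (q := 4) hfs.1 hdg.1).trans_eq ?_)
  · rw [eLpNorm_comp_measurePreserving hg.1 measurePreserving_fst]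
  · rw [eLpNorm_comp_measurePreserving hf.1 (measurePreserving_splice μ m)]

variable [TopologicalSpace.SeparableSpace H₁] [MeasurableSpace H₁] [BorelSpace H₁]
  [TopologicalSpace.SeparableSpace H₂] [MeasurableSpace H₂] [BorelSpace H₂]
  {X : ℕ → Ω → H₁} {W : ℕ → Ω → H₂}

/-- With common innovations the centred tensors are again a functional of the past, with summable
coupling distances. -/
lemma exists_integral_norm_sum_elemTensor_sq_le (hX : IsLpMApproximable 4 P δ X)
    (hW : IsLpMApproximable 4 P δ W) :
    ∃ c : ℝ, ∀ n : ℕ, ∫ ω, ‖∑ k ∈ Finset.Icc 1 n,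
      (elemTensor (X k ω) (W k ω) - ∫ ω', elemTensor (X 1 ω') (W 1 ω') ∂P)‖ ^ 2 ∂P ≤ c * n := by
  have := hX.iid.isProbabilityMeasure_map
  obtain ⟨f, hfm, hf, hXf, hfs⟩ := hX.exists_representation
  obtain ⟨g, hgm, hg, hWg, hgs⟩ := hW.exists_representation
  set μ := P.map (δ 0)
  set M := ∫ ω', elemTensor (X 1 ω') (W 1 ω') ∂P
  have hFm : MemLp (fun p => elemTensor (f p) (g p)) 2 (iidLaw μ) := memLp_elemTensor hf hg
  have hM : ∫ p, elemTensor (f p) (g p) ∂(iidLaw μ) = M := by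
    rw [← integral_comp_of_measurePreserving (hX.iid.measurePreserving_past (1 : ℕ)) hFm.1]
    refine integral_congr_ae ?_
    filter_upwards [hXf 1 le_rfl, hWg 1 le_rfl] with ω h1 h2
    rw [h1, h2]
  have hsum : ∑' m, couplingDist μ 2 (fun p => elemTensor (f p) (g p) - M) (m + 1) < ∞ := by
    refine (ENNReal.tsum_le_tsum fun m =>
      couplingDist_elemTensor_sub_le hf hg M (m + 1)).trans_lt ?_
    rw [ENNReal.tsum_add, ENNReal.tsum_mul_left, ENNReal.tsum_mul_right]
    exact ENNReal.add_lt_top.2 ⟨ENNReal.mul_lt_top hfs hg.2, ENNReal.mul_lt_top hf.2 hgs⟩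
  obtain ⟨c, hc⟩ := hX.iid.exists_integral_norm_sum_past_sq_le (hFm.sub (memLp_const M))
    (by
      simp only [Pi.sub_apply]
      rw [integral_sub (hFm.integrable one_le_two) (integrable_const M), hM]
      simp) hsum
  refine ⟨c, fun n => le_of_eq_of_le (integral_congr_ae ?_) (hc n)⟩
  have hall : ∀ᵐ ω ∂P, ∀ k : ℕ, 1 ≤ k → X k ω = f (past δ k ω) ∧ W k ω = g (past δ k ω) :=
    ae_all_iff.2 fun k => by
      by_cases hk : 1 ≤ k
      · filter_upwards [hXf k hk, hWg k hk] with ω h1 h2 _ using ⟨h1, h2⟩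
      · simp [hk]
  filter_upwards [hall] with ω hω
  congr 2
  refine Finset.sum_congr rfl fun k hk => ?_
  obtain ⟨h1, h2⟩ := hω k (Finset.mem_Icc.1 hk).1
  rw [h1, h2]
  rfl

/-- The sample cross covariance operators converge at the rate `n ^ (-1 / 2)`. -/
lemma exists_measure_crossCovHat_sub_le [CompleteSpace H₂] (hX : IsLpMApproximable 4 P δ X)
    (hW : IsLpMApproximable 4 P δ W) :
    ∃ c : ℝ, ∀ n : ℕ, 1 ≤ n → ∀ s : ℝ, 0 < s →
      P {ω | s ≤ ‖crossCovHat X W n ω - ∫ ω', tens (X 1 ω') (W 1 ω') ∂P‖}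
        ≤ ENNReal.ofReal (c / (n * s ^ 2)) := by
  obtain ⟨c, hc⟩ := exists_integral_norm_sum_elemTensor_sq_le hX hW
  have hX2 : ∀ k, 1 ≤ k → MemLp (X k) 2 P := fun k hk => (hX.memLp k hk).mono_exponent (by norm_num)
  have hW2 : ∀ k, 1 ≤ k → MemLp (W k) 2 P := fun k hk => (hW.memLp k hk).mono_exponent (by norm_num)
  set M := ∫ ω', elemTensor (X 1 ω') (W 1 ω') ∂P with hM
  refine ⟨c, fun n hn s hs => ?_⟩
  have hn0 : (0 : ℝ) < n := by exact_mod_cast hn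
  set R : Ω → HilbertTensor H₁ H₂ :=
    fun ω => ∑ k ∈ Finset.Icc 1 n, (elemTensor (X k ω) (W k ω) - M) with hR
  have hRm : MemLp R 2 P := memLp_finsetSum _ fun k hk =>
    (memLp_elemTensor (hX.memLp k (Finset.mem_Icc.1 hk).1)
      (hW.memLp k (Finset.mem_Icc.1 hk).1)).sub (memLp_const M)
  have hle : ∀ ω, ‖crossCovHat X W n ω - ∫ ω', tens (X 1 ω') (W 1 ω') ∂P‖
      ≤ (n : ℝ)⁻¹ * ‖R ω‖ := fun ω => by
    rw [← abs_of_pos (inv_pos.2 hn0), ← Real.norm_eq_abs, ← norm_smul]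
    refine opNorm_le_of_inner_eq_inner_elemTensor fun u y => ?_
    rw [sub_apply, inner_sub_left,
      inner_integral_tens_apply (hX2 1 le_rfl) (hW2 1 le_rfl),
      ← inner_integral_elemTensor (hX2 1 le_rfl) (hW2 1 le_rfl), ← hM]
    simp only [hR, crossCovHat, smul_apply, sum_apply,
      real_inner_smul_left, sum_inner, inner_tens_apply, inner_sub_left, Finset.sum_sub_distrib,
      Finset.sum_const, Nat.card_Icc, ← Nat.cast_smul_eq_nsmul ℝ]
    field_simp
    simp [mul_comm]
  have hsub : {ω | s ≤ ‖crossCovHat X W n ω - ∫ ω', tens (X 1 ω') (W 1 ω') ∂P‖}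
      ⊆ {ω | (n * s) ^ 2 ≤ ‖R ω‖ ^ 2} := fun ω hω => by
    have h1 : s ≤ (n : ℝ)⁻¹ * ‖R ω‖ := le_trans hω (hle ω)
    have h2 : n * s ≤ ‖R ω‖ := by
      rwa [inv_mul_eq_div, le_div_iff₀ hn0, mul_comm] at h1
    exact pow_le_pow_left₀ (by positivity) h2 2
  refine (measure_mono hsub).trans ?_
  have hint : Integrable (fun ω => ‖R ω‖ ^ 2) P := hRm.integrable_norm_pow (by norm_num)
  -- Chebyshev's inequality, applied to the unnormalised sum `R`.
  have hmk := mul_meas_ge_le_integral_of_nonneg (.of_forall fun ω => by positivity) hint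
    ((n * s) ^ 2)
  rw [← ENNReal.ofReal_toReal (measure_ne_top P _)]
  refine ENNReal.ofReal_le_ofReal ?_
  rw [le_div_iff₀ (by positivity)]
  have h3 : (n * s) ^ 2 * (P {ω | (n * s) ^ 2 ≤ ‖R ω‖ ^ 2}).toReal ≤ c * n := hmk.trans (hc n)
  have h4 : n * ((P {ω | (n * s) ^ 2 ≤ ‖R ω‖ ^ 2}).toReal * (n * s ^ 2)) ≤ n * c := by
    nlinarith [h3]
  exact le_of_mul_le_mul_left h4 hn0

end SampleCovariance

/-! ### Truncated spectral calculus and the deterministic error bound -/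

section EigenSystem

variable {H : Type*} [NormedAddCommGroup H] [InnerProductSpace ℝ H]

/-- Parseval for the sum, Bessel for the coefficients. All spectral norm bounds below are instances.
-/
lemma norm_sum_mul_inner_smul_le {ι : Type*} {v : ι → H} {s : Finset ι}
    (hv : Orthonormal ℝ fun j : s => v j) {a : ι → ℝ} {b : ℝ} (hb : 0 ≤ b)
    (ha : ∀ j ∈ s, |a j| ≤ b) (x : H) :
    ‖∑ j ∈ s, (a j * ⟪v j, x⟫) • v j‖ ≤ b * ‖x‖ := by
  rw [← Finset.sum_coe_sort s fun j => (a j * ⟪v j, x⟫) • v j]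
  refine le_of_sq_le_sq ?_ (by positivity)
  rw [← real_inner_self_eq_norm_sq, hv.inner_sum, mul_pow]
  calc ∑ j : s, (a j * ⟪v j, x⟫) * (a j * ⟪v j, x⟫)
      ≤ ∑ j : s, b ^ 2 * ‖⟪v j, x⟫‖ ^ 2 := Finset.sum_le_sum fun j _ => by
        have h := pow_le_pow_left₀ (abs_nonneg _) (ha j j.2) 2
        rw [sq_abs] at h
        rw [Real.norm_eq_abs, sq_abs]
        nlinarith [sq_nonneg ⟪v j, x⟫]
    _ ≤ b ^ 2 * ‖x‖ ^ 2 := by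
        rw [← Finset.mul_sum]
        exact mul_le_mul_of_nonneg_left (hv.sum_inner_products_le x) (sq_nonneg b)

/-- The projection `x ↦ ∑_{j=1}^K ⟪v j, x⟫ v j` on the first `K` principal components. -/
def pcProj (v : ℕ → H) (K : ℕ) (x : H) : H := ∑ j ∈ Finset.Icc 1 K, ⟪v j, x⟫ • v j

lemma pcProj_sub (v : ℕ → H) (K : ℕ) (x y : H) :
    pcProj v K (x - y) = pcProj v K x - pcProj v K y := by
  simp [pcProj, inner_sub_right, sub_smul]

lemma norm_sub_pcProj_le {v : ℕ → H} {K : ℕ}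
    (hv : Orthonormal ℝ fun j : Finset.Icc 1 K => v j) (x : H) : ‖x - pcProj v K x‖ ≤ ‖x‖ := by
  have h0 : ⟪x - pcProj v K x, pcProj v K x⟫ = 0 := by
    rw [pcProj, ← Finset.sum_coe_sort (Finset.Icc 1 K) fun j => ⟪v j, x⟫ • v j, inner_sub_left,
      hv.inner_sum, inner_sum]
    simp [inner_smul_right, real_inner_comm x]
  have h1 := norm_add_sq_real (x - pcProj v K x) (pcProj v K x)
  rw [h0, sub_add_cancel] at h1
  exact le_of_sq_le_sq (by nlinarith [sq_nonneg ‖pcProj v K x‖]) (norm_nonneg _)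

variable {T : H →L[ℝ] H} {lam : ℕ → ℝ} {v : ℕ → H}

lemma IsEigenSystem.orthonormal_of_subset (h : IsEigenSystem T lam v) {s : Finset ℕ}
    (hs : ∀ j ∈ s, 1 ≤ j ∧ lam j ≠ 0) : Orthonormal ℝ fun j : s => v j :=
  h.orthonormal.comp (fun j : s => ⟨j, hs j j.2⟩) fun _ _ hij =>
    Subtype.ext (congrArg (fun a : {j : ℕ // 1 ≤ j ∧ lam j ≠ 0} => (a : ℕ)) hij)

lemma IsEigenSystem.finite_support (h : IsEigenSystem T lam v) [FiniteDimensional ℝ T.range] :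
    {j | 1 ≤ j ∧ lam j ≠ 0}.Finite := by
  have hmem : ∀ j : {j : ℕ // 1 ≤ j ∧ lam j ≠ 0}, v j ∈ T.range := fun j => by
    refine ⟨(lam j)⁻¹ • v j, ?_⟩
    simp [h.eigen j j.2.1, smul_smul, j.2.2]
  have hli : LinearIndependent ℝ fun j : {j : ℕ // 1 ≤ j ∧ lam j ≠ 0} => (⟨v j, hmem j⟩ : T.range) :=
    LinearIndependent.of_comp T.range.subtype h.orthonormal.linearIndependent
  exact Set.finite_coe_iff.1 hli.finite

/-- The spectral decomposition of a symmetric operator of finite rank. -/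
lemma IsEigenSystem.apply_eq_sum (h : IsEigenSystem T lam v) [FiniteDimensional ℝ T.range]
    (hT : ∀ x y, ⟪T x, y⟫ = ⟪x, T y⟫) (x : H) :
    T x = ∑ j ∈ h.finite_support.toFinset, (lam j * ⟪v j, x⟫) • v j := by
  set s := h.finite_support.toFinset
  have hs : ∀ j ∈ s, 1 ≤ j ∧ lam j ≠ 0 := fun j hj => by simpa [s] using hj
  have horth := h.orthonormal_of_subset hs
  have himg : v '' {j | 1 ≤ j ∧ lam j ≠ 0} = Set.range fun j : s => v j := by
    ext y; simp [s]
  have hmem : T x ∈ Submodule.span ℝ (Set.range fun j : s => v j) := by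
    -- A finite-dimensional span is closed, so the completeness clause puts `T x` in the span
    -- itself.
    have : FiniteDimensional ℝ (Submodule.span ℝ (Set.range fun j : s => v j)) :=
      FiniteDimensional.span_of_finite ℝ (Set.finite_range _)
    have hc := h.complete
    rw [himg, (Submodule.closed_of_finiteDimensional _).closure_eq] at hc
    change T x ∈ ((Submodule.span ℝ (Set.range fun j : s => v j) : Submodule ℝ H) : Set H)
    rw [hc]
    exact subset_closure ⟨x, rfl⟩
  obtain ⟨c, hc⟩ := (Submodule.mem_span_range_iff_exists_fun ℝ).1 hmem
  rw [← Finset.sum_coe_sort s fun j => (lam j * ⟪v j, x⟫) • v j, ← hc]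
  refine Finset.sum_congr rfl fun j _ => ?_
  have h1 : c j = ⟪v j, T x⟫ := by
    rw [← hc]
    exact (horth.inner_right_fintype c j).symm
  rw [h1, ← hT, h.eigen j (hs j j.2).1, real_inner_smul_left]

/-- With `IsEigenSystem.le_norm` this gives `lam 1 = ‖T‖`, so the triangle inequality controls the
top eigenvalue. -/
lemma IsEigenSystem.norm_le (h : IsEigenSystem T lam v) [FiniteDimensional ℝ T.range]
    (hT : ∀ x y, ⟪T x, y⟫ = ⟪x, T y⟫) : ‖T‖ ≤ lam 1 := by
  refine T.opNorm_le_bound (h.nonneg 1 le_rfl) fun x => ?_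
  have hs : ∀ j ∈ h.finite_support.toFinset, 1 ≤ j ∧ lam j ≠ 0 := fun j hj => by simpa using hj
  rw [h.apply_eq_sum hT]
  refine norm_sum_mul_inner_smul_le (h.orthonormal_of_subset hs) (h.nonneg 1 le_rfl)
    (fun j hj => ?_) x
  rw [abs_of_nonneg (h.nonneg j (hs j hj).1)]
  exact h.antitone (Set.mem_Ici.2 le_rfl) (Set.mem_Ici.2 (hs j hj).1) (hs j hj).1

lemma IsEigenSystem.le_norm (h : IsEigenSystem T lam v) : lam 1 ≤ ‖T‖ := by
  by_cases h0 : lam 1 = 0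
  · rw [h0]; positivity
  have h1 : ‖v 1‖ = 1 := h.orthonormal.1 ⟨1, le_rfl, h0⟩
  have h2 := T.le_opNorm (v 1)
  rwa [h.eigen 1 le_rfl, norm_smul, h1, mul_one, mul_one, Real.norm_eq_abs,
    abs_of_nonneg (h.nonneg 1 le_rfl)] at h2

/-- An unbounded set of naturals has `sSup` equal to 0; boundedness makes `truncLevel` a true
maximum when the set is nonempty. -/
lemma IsEigenSystem.bddAbove_truncLevel (h : IsEigenSystem T lam v)
    [FiniteDimensional ℝ T.range] (m : ℝ) :
    BddAbove {j : ℕ | 1 ≤ j ∧ 0 < lam j ∧ lam 1 / lam j ≤ m} :=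
  (h.finite_support.subset fun _ hj => ⟨hj.1, hj.2.1.ne'⟩).bddAbove

/-- Eigenvalues decrease, so the admissible indices form an initial segment. -/
lemma IsEigenSystem.of_le_truncLevel (h : IsEigenSystem T lam v) [FiniteDimensional ℝ T.range]
    {m : ℝ} {j : ℕ} (hj : j ∈ Finset.Icc 1 (truncLevel lam m)) :
    0 < lam j ∧ lam 1 / lam j ≤ m := by
  obtain ⟨h1, hK⟩ := Finset.mem_Icc.1 hj
  have hne : {j : ℕ | 1 ≤ j ∧ 0 < lam j ∧ lam 1 / lam j ≤ m}.Nonempty := by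
    by_contra hne
    rw [Set.not_nonempty_iff_eq_empty] at hne
    have : truncLevel lam m = 0 := by rw [truncLevel, hne]; simp
    omega
  obtain ⟨hK1, hKpos, hKm⟩ := Nat.sSup_mem hne (h.bddAbove_truncLevel m)
  have hle : lam (truncLevel lam m) ≤ lam j :=
    h.antitone (Set.mem_Ici.2 h1) (Set.mem_Ici.2 hK1) hK
  exact ⟨hKpos.trans_le hle,
    (div_le_div_of_nonneg_left (h.nonneg 1 le_rfl) hKpos hle).trans hKm⟩

lemma IsEigenSystem.lt_of_truncLevel_lt (h : IsEigenSystem T lam v)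
    [FiniteDimensional ℝ T.range] {m : ℝ} (hm : 0 < m) {j : ℕ} (h1 : 1 ≤ j) (h0 : lam j ≠ 0)
    (hj : truncLevel lam m < j) : lam j < lam 1 / m := by
  have hpos : 0 < lam j := lt_of_le_of_ne (h.nonneg j h1) (Ne.symm h0)
  by_contra hlt
  have hmem : j ∈ {j : ℕ | 1 ≤ j ∧ 0 < lam j ∧ lam 1 / lam j ≤ m} := by
    refine ⟨h1, hpos, ?_⟩
    rw [div_le_iff₀ hpos]
    rw [not_lt, div_le_iff₀ hm] at hlt
    linarith
  exact absurd (le_csSup (h.bddAbove_truncLevel m) hmem) (not_le.2 hj)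

lemma IsEigenSystem.orthonormal_Icc_truncLevel (h : IsEigenSystem T lam v)
    [FiniteDimensional ℝ T.range] (m : ℝ) :
    Orthonormal ℝ fun j : Finset.Icc 1 (truncLevel lam m) => v j :=
  h.orthonormal_of_subset fun _ hj =>
    ⟨(Finset.mem_Icc.1 hj).1, (h.of_le_truncLevel hj).1.ne'⟩

/-- Only discarded eigenvalues survive, each below `lam 1 / m`. -/
lemma IsEigenSystem.norm_apply_sub_pcProj_le (h : IsEigenSystem T lam v)
    [FiniteDimensional ℝ T.range] (hT : ∀ x y, ⟪T x, y⟫ = ⟪x, T y⟫) {m : ℝ} (hm : 0 < m) (x : H) :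
    ‖T x - pcProj v (truncLevel lam m) (T x)‖ ≤ lam 1 / m * ‖x‖ := by
  set K := truncLevel lam m
  set s := h.finite_support.toFinset
  have hs : ∀ j ∈ s, 1 ≤ j ∧ lam j ≠ 0 := fun j hj => by simpa [s] using hj
  have hKs : Finset.Icc 1 K ⊆ s := fun j hj => by
    simpa [s] using ⟨(Finset.mem_Icc.1 hj).1, (h.of_le_truncLevel hj).1.ne'⟩
  have h1 : pcProj v K (T x) = ∑ j ∈ Finset.Icc 1 K, (lam j * ⟪v j, x⟫) • v j :=
    Finset.sum_congr rfl fun j hj => by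
      rw [← hT, h.eigen j (Finset.mem_Icc.1 hj).1, real_inner_smul_left]
  have h2 : T x - pcProj v K (T x) = ∑ j ∈ s \ Finset.Icc 1 K, (lam j * ⟪v j, x⟫) • v j := by
    rw [h1, sub_eq_iff_eq_add, Finset.sum_sdiff hKs]
    exact h.apply_eq_sum hT x
  rw [h2]
  refine norm_sum_mul_inner_smul_le
    (h.orthonormal_of_subset fun j hj => hs j (Finset.mem_sdiff.1 hj).1)
    (div_nonneg (h.nonneg 1 le_rfl) hm.le) (fun j hj => ?_) x
  obtain ⟨hj1, hj2⟩ := Finset.mem_sdiff.1 hj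
  obtain ⟨hj0, hjl⟩ := hs j hj1
  rw [abs_of_nonneg (h.nonneg j hj0)]
  refine (h.lt_of_truncLevel_lt hm hj0 hjl ?_).le
  simp only [Finset.mem_Icc, not_and, not_le] at hj2
  exact hj2 hj0

/-- Retained inverse eigenvalues are at most `m / lam 1`. If `lam 1 = 0`, nothing is retained and
both sides are 0. -/
lemma IsEigenSystem.norm_sum_div_smul_le (h : IsEigenSystem T lam v)
    [FiniteDimensional ℝ T.range] {m : ℝ} (hm : 0 < m) (x : H) :
    ‖∑ j ∈ Finset.Icc 1 (truncLevel lam m), (⟪v j, x⟫ / lam j) • v j‖ ≤ m / lam 1 * ‖x‖ := by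
  have h1 := h.nonneg 1 le_rfl
  simp_rw [div_eq_inv_mul (⟪v _, x⟫)]
  refine norm_sum_mul_inner_smul_le (h.orthonormal_Icc_truncLevel m) (by positivity)
    (fun j hj => ?_) x
  obtain ⟨hpos, hle⟩ := h.of_le_truncLevel hj
  have h1pos : 0 < lam 1 := hpos.trans_le
    (h.antitone (Set.mem_Ici.2 le_rfl) (Set.mem_Ici.2 (Finset.mem_Icc.1 hj).1)
      (Finset.mem_Icc.1 hj).1)
  rw [abs_of_pos (inv_pos.2 hpos), le_div_iff₀ h1pos, inv_mul_eq_div]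
  exact hle

variable {H₂ : Type*} [NormedAddCommGroup H₂] [InnerProductSpace ℝ H₂]

/-- The error of the principal components estimator, in terms of the noise operator `L` and the
distance of `T` from an operator `C` whose range almost contains `x`. -/
lemma IsEigenSystem.norm_sub_pcEstimator_le (h : IsEigenSystem T lam v)
    [FiniteDimensional ℝ T.range] (hT : ∀ x y, ⟪T x, y⟫ = ⟪x, T y⟫) {m : ℝ} (hm : 0 < m)
    (A L : H →L[ℝ] H₂) (C : H →L[ℝ] H) (x u : H) :
    ‖A x - pcEstimator (A ∘L T + L) lam v (truncLevel lam m) x‖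
      ≤ ‖A‖ * (‖x - C u‖ + ‖T - C‖ * ‖u‖ + lam 1 / m * ‖u‖) + ‖L‖ * (m / lam 1 * ‖x‖) := by
  set K := truncLevel lam m
  have hest : pcEstimator (A ∘L T + L) lam v K x
      = A (pcProj v K x) + L (∑ j ∈ Finset.Icc 1 K, (⟪v j, x⟫ / lam j) • v j) := by
    rw [pcEstimator, pcProj, map_sum, map_sum, ← Finset.sum_add_distrib]
    refine Finset.sum_congr rfl fun j hj => ?_
    have hpos := (h.of_le_truncLevel hj).1
    rw [add_apply, ContinuousLinearMap.comp_apply, h.eigen j (Finset.mem_Icc.1 hj).1, map_smul,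
      smul_add, smul_smul, div_mul_cancel₀ _ hpos.ne', map_smul, map_smul]
  have horth := h.orthonormal_Icc_truncLevel m
  have hproj : ‖x - pcProj v K x‖ ≤ ‖x - C u‖ + ‖T - C‖ * ‖u‖ + lam 1 / m * ‖u‖ := by
    -- Apply I − Π to x = (x − C u) − (T − C)u + T u: it is a contraction on the first two terms,
    -- and the spectral tail bound handles the third.
    have hdec : x - pcProj v K x = ((x - C u) - pcProj v K (x - C u))
        - ((T - C) u - pcProj v K ((T - C) u)) + (T u - pcProj v K (T u)) := by
      simp only [sub_apply, pcProj_sub]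
      abel
    rw [hdec]
    refine (norm_add_le _ _).trans (add_le_add ((norm_sub_le _ _).trans (add_le_add ?_ ?_)) ?_)
    · exact norm_sub_pcProj_le horth _
    · exact (norm_sub_pcProj_le horth _).trans ((T - C).le_opNorm u)
    · exact h.norm_apply_sub_pcProj_le hT hm u
  rw [hest, ← sub_sub, ← map_sub]
  refine (norm_sub_le _ _).trans (add_le_add ?_ ?_)
  · exact (A.le_opNorm _).trans (mul_le_mul_of_nonneg_left hproj (norm_nonneg _))
  · exact (L.le_opNorm _).trans
      (mul_le_mul_of_nonneg_left (h.norm_sum_div_smul_le hm x) (norm_nonneg _))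

end EigenSystem

/-! ### Algebra of the sample operators -/

section SampleOperators

variable {Ω H H₂ : Type*} [NormedAddCommGroup H] [InnerProductSpace ℝ H]
  [NormedAddCommGroup H₂] [InnerProductSpace ℝ H₂] (X : ℕ → Ω → H) (n : ℕ) (ω : Ω)

lemma covHat_apply (x : H) :
    covHat X n ω x = (n : ℝ)⁻¹ • ∑ k ∈ Finset.Icc 1 n, ⟪X k ω, x⟫ • X k ω := by
  simp only [covHat, crossCovHat, smul_apply, sum_apply, tens_apply]

lemma inner_covHat (x y : H) : ⟪covHat X n ω x, y⟫ = ⟪x, covHat X n ω y⟫ := by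
  simp only [covHat_apply, real_inner_smul_left, real_inner_smul_right, sum_inner, inner_sum]
  congr 1
  refine Finset.sum_congr rfl fun k _ => ?_
  rw [real_inner_comm x, mul_comm]

instance finiteDimensional_range_covHat : FiniteDimensional ℝ (covHat X n ω).range := by
  have : FiniteDimensional ℝ (Submodule.span ℝ ((fun k => X k ω) '' Finset.Icc 1 n)) :=
    FiniteDimensional.span_of_finite ℝ ((Finset.finite_toSet _).image _)
  refine Submodule.finiteDimensional_of_le
    (S₂ := Submodule.span ℝ ((fun k => X k ω) '' Finset.Icc 1 n)) ?_
  rintro _ ⟨x, rfl⟩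
  change covHat X n ω x ∈ _
  rw [covHat_apply]
  exact Submodule.smul_mem _ _ (Submodule.sum_mem _ fun k hk =>
    Submodule.smul_mem _ _ (Submodule.subset_span ⟨k, hk, rfl⟩))

lemma crossCovHat_eq_of_model {X : ℕ → Ω → H} {ε Y : ℕ → Ω → H₂} {A : H →L[ℝ] H₂} {n : ℕ} {ω : Ω}
    (h : ∀ k, 1 ≤ k → Y k ω = A (X k ω) + ε k ω) :
    crossCovHat X Y n ω = A ∘L covHat X n ω + crossCovHat X ε n ω := by
  ext x
  simp only [add_apply, ContinuousLinearMap.comp_apply, covHat_apply]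
  simp only [crossCovHat, smul_apply, sum_apply, tens_apply, map_smul, map_sum, ← smul_add,
    ← Finset.sum_add_distrib]
  congr 1
  exact Finset.sum_congr rfl fun k hk => by rw [h k (Finset.mem_Icc.1 hk).1]

end SampleOperators

/-! ### Support of the regressors -/

section Support

variable {Ω H : Type*} [MeasurableSpace Ω] {P : Measure Ω}
  [NormedAddCommGroup H] [InnerProductSpace ℝ H] [CompleteSpace H]
  [TopologicalSpace.SeparableSpace H] {X : Ω → H}

/-- A square integrable random variable takes its values in the closure of the range of its
second moment operator. -/
lemma ae_mem_closure_range_integral_tens (hX : MemLp X 2 P) :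
    ∀ᵐ ω ∂P, X ω ∈ closure (Set.range (∫ ω', tens (X ω') (X ω') ∂P : H →L[ℝ] H)) := by
  set C := ∫ ω', tens (X ω') (X ω') ∂P with hC
  have : SecondCountableTopology H := UniformSpace.secondCountable_of_separable H
  have hadj : C.adjoint = C := by
    refine ((ContinuousLinearMap.eq_adjoint_iff C C).2 fun x y => ?_).symm
    rw [real_inner_comm (C y) x, inner_integral_tens_apply hX hX, inner_integral_tens_apply hX hX]
    simp_rw [mul_comm]
  -- E⟪X, u⟫² = ⟪C u, u⟫ = 0. The null set depends on `u`, hence the passage to a dense sequence in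
  -- the kernel.
  have hker : ∀ u ∈ C.ker, ∀ᵐ ω ∂P, ⟪X ω, u⟫ = 0 := fun u hu => by
    have h0 : ∫ ω, ⟪X ω, u⟫ * ⟪X ω, u⟫ ∂P = 0 := by
      rw [← inner_integral_tens_apply hX hX, ← hC, show C u = 0 from hu, inner_zero_left]
    have hu2 : MemLp (fun ω => ⟪X ω, u⟫) 2 P := hX.inner_const u
    rw [integral_eq_zero_iff_of_nonneg (fun ω => mul_self_nonneg _)
      (hu2.integrable_mul hu2)] at h0
    filter_upwards [h0] with ω hω
    exact mul_self_eq_zero.1 hω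
  have hall : ∀ᵐ ω ∂P, ∀ i, ⟪X ω, (TopologicalSpace.denseSeq C.ker i : H)⟫ = 0 :=
    ae_all_iff.2 fun i => hker _ (TopologicalSpace.denseSeq C.ker i).2
  filter_upwards [hall] with ω hω
  have hmem : X ω ∈ C.kerᗮ := by
    rw [Submodule.mem_orthogonal']
    intro u hu
    have hcl : IsClosed {w : C.ker | ⟪X ω, (w : H)⟫ = 0} :=
      isClosed_eq (by fun_prop) continuous_const
    have := (TopologicalSpace.denseRange_denseSeq C.ker).closure_eq ▸
      closure_minimal (Set.range_subset_iff.2 hω) hcl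
    exact this (Set.mem_univ ⟨u, hu⟩)
  rw [ContinuousLinearMap.orthogonal_ker, hadj] at hmem
  exact hmem

/-- Up to small probability, `X` is close to the image under its second moment operator of one of
finitely many vectors. -/
lemma exists_measure_preimage_compl_lt [IsProbabilityMeasure P] [MeasurableSpace H] [BorelSpace H]
    (hX : MemLp X 2 P) {η : ℝ} (hη : 0 < η) {τ : ℝ≥0∞} (hτ : 0 < τ) :
    ∃ (s : Finset H) (R : ℝ), 0 < R ∧ P (X ⁻¹'
      ((⋃ u ∈ s, Metric.ball ((∫ ω', tens (X ω') (X ω') ∂P : H →L[ℝ] H) u) η)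
        ∩ Metric.ball 0 R)ᶜ) < τ := by
  classical
  set C := ∫ ω', tens (X ω') (X ω') ∂P with hC
  set D := TopologicalSpace.denseSeq H
  set E : ℕ → Set H := fun N =>
    (⋃ u ∈ (Finset.range N).image D, Metric.ball (C u) η) ∩ Metric.ball 0 (N + 1) with hE
  have hEmono : Monotone E := fun N M hNM => by
    refine Set.inter_subset_inter (Set.biUnion_subset_biUnion_left ?_)
      (Metric.ball_subset_ball (by gcongr))
    exact Finset.coe_subset.2 (Finset.image_subset_image (Finset.range_mono hNM))
  have hEmeas : ∀ N, MeasurableSet (E N) := fun N =>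
    ((isOpen_biUnion fun _ _ => Metric.isOpen_ball).inter Metric.isOpen_ball).measurableSet
  -- The sets `E N` exhaust the closure of the range of `C`; continuity from above then yields one
  -- good `N`.
  have hnull : P (⋂ N, X ⁻¹' (E N)ᶜ) = 0 := by
    refine measure_mono_null (fun ω hω => ?_)
      (ae_iff.1 (ae_mem_closure_range_integral_tens hX))
    intro hcl
    rw [← hC] at hcl
    have hcl' : X ω ∈ closure (Set.range fun i => C (D i)) := by
      refine closure_minimal ?_ isClosed_closure hcl
      have := (TopologicalSpace.denseRange_denseSeq H)
      exact C.continuous.range_subset_closure_image_dense this |>.trans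
        (closure_mono (by rintro _ ⟨_, ⟨i, rfl⟩, rfl⟩; exact ⟨i, rfl⟩))
    obtain ⟨_, ⟨i, rfl⟩, hi⟩ := Metric.mem_closure_iff.1 hcl' η hη
    obtain ⟨k, hk⟩ := exists_nat_gt ‖X ω‖
    refine Set.mem_iInter.1 hω (max (i + 1) k) ⟨?_, ?_⟩
    · exact Set.mem_biUnion (x := D i) (Finset.mem_image_of_mem D (by simp)) hi
    · rw [mem_ball_zero_iff]
      have : (k : ℝ) ≤ (max (i + 1) k : ℕ) := by exact_mod_cast le_max_right _ _
      linarith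
  have htend := tendsto_measure_iInter_atTop (μ := P) (s := fun N => X ⁻¹' (E N)ᶜ)
    (fun N => hX.1.aemeasurable.nullMeasurable (hEmeas N).compl)
    (fun N M hNM => Set.preimage_mono (Set.compl_subset_compl.2 (hEmono hNM)))
    ⟨0, measure_ne_top P _⟩
  rw [hnull] at htend
  obtain ⟨N, hN⟩ := (htend.eventually_lt_const hτ).exists
  exact ⟨_, N + 1, by positivity, hN⟩

/-- If the second moment operator vanishes, then so does the sequence. -/
lemma IsLpMApproximable.ae_eq_zero
    {S : Type*} [MeasurableSpace S] [MeasurableSpace H] [BorelSpace H]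
    [IsProbabilityMeasure P] {δ : ℤ → Ω → S} {X : ℕ → Ω → H}
    (hX : IsLpMApproximable 4 P δ X) (hC : ∫ ω, tens (X 1 ω) (X 1 ω) ∂P = 0) {n : ℕ}
    (hn : 1 ≤ n) : ∀ᵐ ω ∂P, X n ω = 0 := by
  have h2 : MemLp (X 1) 2 P := (hX.memLp 1 le_rfl).mono_exponent (by norm_num)
  have h1 := ae_mem_closure_range_integral_tens h2
  rw [hC] at h1
  have hr : Set.range (0 : H →L[ℝ] H) = {0} := by ext; simp
  have h0 : P (X 1 ⁻¹' {0}ᶜ) = 0 := by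
    rw [hr, closure_singleton] at h1
    exact ae_iff.1 h1
  rw [← (hX.identDistrib hn).measure_mem_eq (measurableSet_singleton 0).compl] at h0
  exact ae_iff.2 h0

end Support

end FunctionalRegression

end

/-! ### Assembly: convergence in probability -/

open FunctionalRegression

theorem theorem2
    {Ω S H₁ H₂ : Type*} [MeasurableSpace Ω] [MeasurableSpace S]
    [NormedAddCommGroup H₁] [InnerProductSpace ℝ H₁] [CompleteSpace H₁]
    [TopologicalSpace.SeparableSpace H₁] [MeasurableSpace H₁] [BorelSpace H₁]
    [NormedAddCommGroup H₂] [InnerProductSpace ℝ H₂] [CompleteSpace H₂]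
    [TopologicalSpace.SeparableSpace H₂] [MeasurableSpace H₂] [BorelSpace H₂]
    (P : Measure Ω) [IsProbabilityMeasure P]
    (δ : ℤ → Ω → S) (X : ℕ → Ω → H₁) (ε Y : ℕ → Ω → H₂) (Ψ : H₁ →L[ℝ] H₂)
    (hA : FunctionalRegression.AssumptionA P δ X ε)
    (hmodel : ∀ k, 1 ≤ k → ∀ᵐ ω ∂P, Y k ω = Ψ (X k ω) + ε k ω)
    (lam : ℕ → Ω → ℕ → ℝ) (v : ℕ → Ω → ℕ → H₁)
    (heig : ∀ n, 1 ≤ n → ∀ ω,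
      FunctionalRegression.IsEigenSystem (FunctionalRegression.covHat X n ω) (lam n ω) (v n ω))
    (m : ℕ → ℝ) (hm : Tendsto m atTop atTop)
    (hmo : m =o[atTop] fun n : ℕ => Real.sqrt n) :
    TendstoInMeasure P
      (fun n ω => ‖Ψ (X n ω) - FunctionalRegression.pcEstimator
        (FunctionalRegression.crossCovHat X Y n ω) (lam n ω) (v n ω)
        (FunctionalRegression.truncLevel (lam n ω) (m n)) (X n ω)‖)
      atTop (fun _ => 0) := by
  rw [tendstoInMeasure_iff_norm]
  intro e he
  simp only [sub_zero, norm_norm]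
  set C := ∫ ω, tens (X 1 ω) (X 1 ω) ∂P with hC
  -- The main argument divides by `‖C‖`; in the degenerate case `X n = 0` almost surely and the
  -- error vanishes.
  by_cases hC0 : C = 0
  · refine tendsto_const_nhds.congr' ?_
    filter_upwards [eventually_ge_atTop 1] with n hn
    refine (measure_mono_null (fun ω hω h0 => ?_)
      (ae_iff.1 (hA.approx_X.ae_eq_zero hC0 hn))).symm
    simp only [Set.mem_ofPred_eq, h0, pcEstimator, inner_zero_right, zero_div, zero_smul,
      Finset.sum_const_zero, map_zero, sub_zero, norm_zero] at hω
    linarith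
  have hc : 0 < ‖C‖ := norm_pos_iff.2 hC0
  set c := ‖C‖
  have hX2 : MemLp (X 1) 2 P := (hA.approx_X.memLp 1 le_rfl).mono_exponent (by norm_num)
  obtain ⟨c₁, hc₁⟩ := exists_measure_crossCovHat_sub_le hA.approx_X hA.approx_X
  obtain ⟨c₂, hc₂⟩ := exists_measure_crossCovHat_sub_le hA.approx_X hA.approx_ε
  have horth : ∫ ω, tens (X 1 ω) (ε 1 ω) ∂P = 0 := hA.orthogonal 1 le_rfl
  simp only [horth, sub_zero] at hc₂
  have hmodel' : ∀ᵐ ω ∂P, ∀ k, 1 ≤ k → Y k ω = Ψ (X k ω) + ε k ω :=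
    ae_all_iff.2 fun k => by
      by_cases hk : 1 ≤ k
      · filter_upwards [hmodel k hk] with ω hω _ using hω
      · simp [hk]
  rw [ENNReal.tendsto_nhds_zero]
  intro τ hτ
  obtain ⟨r, hr0, hrτ⟩ := ENNReal.lt_iff_exists_nnreal_btwn.1 hτ
  have hr : (0 : ℝ) < r := by exact_mod_cast hr0
  -- Four error terms of at most `e / 5` each stay strictly below `e`; three bad events get
  -- probability `r / 3` each. The `+ 1` covers `Ψ = 0`.
  obtain ⟨s, R, hR, hsR⟩ := exists_measure_preimage_compl_lt hX2
    (η := e / (5 * (‖Ψ‖ + 1))) (by positivity) (τ := ENNReal.ofReal (r / 3))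
    (ENNReal.ofReal_pos.2 (by positivity))
  obtain ⟨B, hB0, hB⟩ : ∃ B : ℝ, 0 < B ∧ ∀ u ∈ s, ‖u‖ ≤ B :=
    ⟨∑ u ∈ s, ‖u‖ + 1, by positivity, fun u hu =>
      (Finset.single_le_sum (f := fun u => ‖u‖) (fun _ _ => norm_nonneg _) hu).trans
        (by linarith)⟩
  -- `t ≤ c / 2` keeps the top sample eigenvalue between `c / 2` and `3 * c / 2`.
  obtain ⟨t, ht0, htc, htB⟩ : ∃ t : ℝ, 0 < t ∧ t ≤ c / 2 ∧ ‖Ψ‖ * (t * B) ≤ e / 5 := by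
    refine ⟨min (c / 2) (e / (5 * (‖Ψ‖ + 1) * B)), by positivity, min_le_left _ _, ?_⟩
    have h1 : min (c / 2) (e / (5 * (‖Ψ‖ + 1) * B)) * B ≤ e / (5 * (‖Ψ‖ + 1)) := by
      calc _ ≤ e / (5 * (‖Ψ‖ + 1) * B) * B := by gcongr; exact min_le_right _ _
        _ = _ := by field_simp
    calc _ ≤ (‖Ψ‖ + 1) * (e / (5 * (‖Ψ‖ + 1))) := by gcongr; linarith
      _ = _ := by field_simp
  -- At threshold `a / √n` the factor `n` in the Chebyshev bound cancels, leaving `c₂ / a ^ 2`.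
  obtain ⟨a, ha0, ha⟩ : ∃ a : ℝ, 0 < a ∧ c₂ / a ^ 2 ≤ r / 3 := by
    have h : Tendsto (fun a : ℝ => c₂ / a ^ 2) atTop (𝓝 0) :=
      tendsto_const_nhds.div_atTop (tendsto_pow_atTop two_ne_zero)
    exact ((eventually_gt_atTop 0).and (h.eventually_le_const (by positivity))).exists
  have hev₁ : ∀ᶠ n : ℕ in atTop, c₁ / (n * t ^ 2) ≤ r / 3 :=
    (tendsto_const_nhds.div_atTop
      (tendsto_natCast_atTop_atTop.atTop_mul_const (by positivity))).eventually_le_const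
        (by positivity)
  have hev₂ : ∀ᶠ n : ℕ in atTop, ‖Ψ‖ * (3 * c / 2 / m n * B) ≤ e / 5 := by
    have h : Tendsto (fun n => ‖Ψ‖ * (3 * c / 2 / m n * B)) atTop (𝓝 (‖Ψ‖ * (0 * B))) :=
      ((tendsto_const_nhds.div_atTop hm).mul_const B).const_mul ‖Ψ‖
    exact h.eventually_le_const (by simpa using by positivity)
  have hev₃ : ∀ᶠ n : ℕ in atTop, a * (2 / c) * R * (m n / Real.sqrt n) ≤ e / 5 := by
    have h := hmo.tendsto_div_nhds_zero.const_mul (a * (2 / c) * R)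
    exact h.eventually_le_const (by simpa using by positivity)
  filter_upwards [hev₁, hev₂, hev₃, eventually_ge_atTop 1, hm.eventually_gt_atTop 0]
    with n h₁ h₂ h₃ hn hmn
  have hn0 : (0 : ℝ) < n := by exact_mod_cast hn
  have hsq : 0 < Real.sqrt n := Real.sqrt_pos.2 hn0
  set E := (⋃ u ∈ s, Metric.ball (C u) (e / (5 * (‖Ψ‖ + 1)))) ∩ Metric.ball 0 R with hE
  have hEm : MeasurableSet E :=
    ((isOpen_biUnion fun _ _ => Metric.isOpen_ball).inter Metric.isOpen_ball).measurableSet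
  have hsub : {ω | e ≤ ‖Ψ (X n ω) - pcEstimator (crossCovHat X Y n ω) (lam n ω) (v n ω)
        (truncLevel (lam n ω) (m n)) (X n ω)‖}
      ⊆ (X n ⁻¹' Eᶜ ∪ {ω | t ≤ ‖crossCovHat X X n ω - C‖})
        ∪ ({ω | a / Real.sqrt n ≤ ‖crossCovHat X ε n ω‖}
          ∪ {ω | ¬ ∀ k, 1 ≤ k → Y k ω = Ψ (X k ω) + ε k ω}) := by
    intro ω hω
    by_contra hgood
    simp only [Set.mem_union, Set.mem_preimage, Set.mem_compl_iff, Set.mem_ofPred_eq, not_or,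
      not_not, not_le] at hgood
    obtain ⟨⟨⟨hXu, hXR⟩, hCt⟩, hLa, hmod⟩ := hgood
    obtain ⟨u, hu, hXu⟩ := Set.mem_iUnion₂.1 hXu
    rw [mem_ball_iff_norm] at hXu
    rw [mem_ball_zero_iff] at hXR
    change ‖covHat X n ω - C‖ < t at hCt
    have hsys := heig n hn ω
    have hlo : c / 2 ≤ lam n ω 1 := by
      have h1 := hsys.norm_le (inner_covHat X n ω)
      have h2 := norm_sub_norm_le C (covHat X n ω)
      rw [norm_sub_rev] at h2
      linarith
    have hhi : lam n ω 1 ≤ 3 * c / 2 := by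
      have h1 := hsys.le_norm
      have h2 := norm_sub_norm_le (covHat X n ω) C
      linarith
    have hmain := hsys.norm_sub_pcEstimator_le (inner_covHat X n ω) hmn Ψ
      (crossCovHat X ε n ω) C (X n ω) u
    rw [← crossCovHat_eq_of_model hmod] at hmain
    have hb₁ : ‖Ψ‖ * ‖X n ω - C u‖ ≤ e / 5 :=
      calc _ ≤ (‖Ψ‖ + 1) * (e / (5 * (‖Ψ‖ + 1))) := by gcongr; linarith
        _ = _ := by field_simp
    have hb₂ : ‖Ψ‖ * (‖covHat X n ω - C‖ * ‖u‖) ≤ e / 5 :=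
      le_trans (by gcongr; exact hB u hu) htB
    have hb₃ : ‖Ψ‖ * (lam n ω 1 / m n * ‖u‖) ≤ e / 5 :=
      le_trans (by gcongr; exact hB u hu) h₂
    have hb₄ : ‖crossCovHat X ε n ω‖ * (m n / lam n ω 1 * ‖X n ω‖) ≤ e / 5 :=
      calc _ ≤ a / Real.sqrt n * (m n / (c / 2) * R) := by
            have : 0 < lam n ω 1 := by linarith
            gcongr
        _ = a * (2 / c) * R * (m n / Real.sqrt n) := by field_simp
        _ ≤ _ := h₃
    have : e ≤ _ := le_trans hω hmain
    rw [mul_add, mul_add] at this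
    linarith
  -- `X n` has the law of `X 1`, so the finite set `s` and the radius `R` serve every `n`.
  have hm₁ : P (X n ⁻¹' Eᶜ) ≤ ENNReal.ofReal (r / 3) := by
    rw [(hA.approx_X.identDistrib hn).measure_mem_eq hEm.compl]
    exact hsR.le
  have hm₂ : P {ω | t ≤ ‖crossCovHat X X n ω - C‖} ≤ ENNReal.ofReal (r / 3) :=
    (hc₁ n hn t ht0).trans (ENNReal.ofReal_le_ofReal h₁)
  have hm₃ : P {ω | a / Real.sqrt n ≤ ‖crossCovHat X ε n ω‖} ≤ ENNReal.ofReal (r / 3) := by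
    refine (hc₂ n hn _ (by positivity)).trans (ENNReal.ofReal_le_ofReal (le_trans ?_ ha))
    rw [div_pow, Real.sq_sqrt hn0.le, mul_div_cancel₀ _ hn0.ne']
  calc _ ≤ _ := measure_mono hsub
    _ ≤ (ENNReal.ofReal (r / 3) + ENNReal.ofReal (r / 3)) + (ENNReal.ofReal (r / 3) + 0) := by
        refine (measure_union_le _ _).trans (add_le_add ((measure_union_le _ _).trans
          (add_le_add hm₁ hm₂)) ((measure_union_le _ _).trans (add_le_add hm₃ ?_)))
        exact (ae_iff.1 hmodel').le
    _ = r := by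
        rw [add_zero, ← ENNReal.ofReal_add (by positivity) (by positivity),
          ← ENNReal.ofReal_add (by positivity) (by positivity),
          show (r : ℝ) / 3 + r / 3 + r / 3 = r by ring, ENNReal.ofReal_coe_nnreal]
    _ ≤ τ := hrτ.le
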